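/- For an integer $k\ge 1$ let $\operatorname{Li}_k(z)=\sum_{n\ge 1} n^{-k}z^n$ for $|z|<1$. (1) Let $k\ge 2$. Call $\alpha\in\mathbb{C}$ a singularity of the analytic continuation of $\operatorname{Li}_k$ if there is a path in $\mathbb{C}$ from $0$ to $\alpha$ such that the germ of $\operatorname{Li}_k$ at $0$ has an analytic continuation along the path up to, but not including, its endpoint $\alpha$. Then the set of singularities in $\mathbb{C}$ of the analytic continuation of $\operatorname{Li}_k$ is exactly $\{0,1\}$. (2) Let $k\ge 1$. The function $\operatorname{Li}_k$ extends holomorphically to $\mathbb{C}\setminus[1,\infty)$; this extension is called its principal branch. The principal branch has an isolated singularity at $1$: it does not extend holomorphically to a neighbourhood of $1$, but for some $r>0$ it continues analytically along all paths in $\{0<|z-1|<r\}$ that start outside $[1,\infty)$. Its monodromy at $1$, that is $\Delta_1\operatorname{Li}_k=(\operatorname{Li}_k)_+-\operatorname{Li}_k$, where $(\operatorname{Li}_k)_+$ is the analytic continuation of the principal branch once around $1$ in the positive direction on a small circle centred at $1$, is holomorphic at $z=1$, and near $1$ $$\Delta_1\operatorname{Li}_k(z)=-\frac{2\pi i}{(k-1)!}(\log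 z)^{k-1},$$ where $\log$ is the branch of the logarithm near $1$ with $\log 1=0$. -/

import Mathlib

open Set Filter Topology
open scoped unitInterval

noncomputable section

/-- The power series `∑_{n ≥ 1} z ^ n / n ^ k`, which converges for `‖z‖ < 1`
(indexed by `n + 1` with `n : ℕ`). -/
def polylogSeries (k : ℕ) (z : ℂ) : ℂ :=
  ∑' n : ℕ, z ^ (n + 1) / ((n : ℂ) + 1) ^ k

/-- `Φ` is an analytic continuation along the part `γ|_S` of the curve `γ`: for each time `t ∈ S`
the function `Φ t` represents a holomorphic germ at `γ t`, and for times `s ∈ S` close to `t`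
the germ at `γ s` is the one induced by `Φ t`. -/
structure IsContinuationAlong (γ : I → ℂ) (S : Set I) (Φ : I → ℂ → ℂ) : Prop where
  analyticAt : ∀ t ∈ S, AnalyticAt ℂ (Φ t) (γ t)
  eventuallyEq : ∀ t ∈ S, ∀ᶠ s in 𝓝[S] t, Φ s =ᶠ[𝓝 (γ s)] Φ t

/-- The germ of `f` at the starting point of `γ` has an analytic continuation along `γ|_S`. -/
def ContinuesAlong (f : ℂ → ℂ) (γ : I → ℂ) (S : Set I) : Prop :=
  ∃ Φ : I → ℂ → ℂ, IsContinuationAlong γ S Φ ∧ Φ 0 =ᶠ[𝓝 (γ 0)] f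

/-- The singularities in `ℂ` of the (multivalued) analytic continuation of the germ of `f` at `b`:
the points `α` for which there is a path from `b` to `α` such that the germ continues along
the path up to, but not including, its endpoint `α`. -/
def continuationSingularities (f : ℂ → ℂ) (b : ℂ) : Set ℂ :=
  {α | ∃ γ : Path b α, ContinuesAlong f γ (Iio 1) ∧ ¬ ContinuesAlong f γ univ}

/-- The disc of centre `α` and radius `r` without its centre. -/
def puncturedDisc (α : ℂ) (r : ℝ) : Set ℂ := Metric.ball α r \ {α}

/-- The loop based at `z` that turns once around `α` in the positive direction, on the circle
of centre `α` through `z`. -/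
def circleLoop (α z : ℂ) : Path z z where
  toFun t := α + (z - α) * Complex.exp (2 * Real.pi * Complex.I * ((t : ℝ) : ℂ))
  continuous_toFun := by fun_prop
  source' := by simp
  target' := by simp

/-- For `F` holomorphic on the open set `U`: the branch `F` continues analytically along all
paths in the punctured disc of centre `α` and radius `r` that start in `U`
(so that the disc contains no singularity of the continuation of `F`, except perhaps `α`). -/
def ContinuesInPuncturedDisc (F : ℂ → ℂ) (U : Set ℂ) (α : ℂ) (r : ℝ) : Prop :=
  ∀ z ∈ U ∩ puncturedDisc α r, ∀ (w : ℂ) (γ : Path z w),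
    (∀ t, γ t ∈ puncturedDisc α r) → ContinuesAlong F γ univ

/-- For `F` holomorphic on the open set `U`, with `α` in the closure of `U`: the point `α` is an
isolated singularity of `F`. -/
def HasIsolatedSingularityAt (F : ℂ → ℂ) (U : Set ℂ) (α : ℂ) : Prop :=
  (∃ r > 0, ContinuesInPuncturedDisc F U α r) ∧
    ¬ ∃ g : ℂ → ℂ, AnalyticAt ℂ g α ∧ ∀ᶠ z in 𝓝[U] α, g z = F z

/-- For `F` holomorphic on the open set `U`: the monodromy `Δ_α F = F₊ - F` of `F` at `α` is
the function `Δ` near `α`. Here `F₊` is the continuation of `F` once around `α` in the positive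
direction, within a disc without other singularities; by the first conjunct it exists. -/
def HasMonodromyAt (F : ℂ → ℂ) (U : Set ℂ) (α : ℂ) (Δ : ℂ → ℂ) : Prop :=
  ∃ r > 0, ContinuesInPuncturedDisc F U α r ∧
    ∀ z ∈ U ∩ puncturedDisc α r, ∀ Φ : I → ℂ → ℂ,
      IsContinuationAlong (circleLoop α z) univ Φ → Φ 0 =ᶠ[𝓝 z] F →
        (fun w => Φ 1 w - F w) =ᶠ[𝓝 z] Δ

/-- The plane cut along the half-line `[1, ∞)`. -/
def cutPlane : Set ℂ := {z | ¬ (1 ≤ z.re ∧ z.im = 0)}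

/-- `L` is the principal branch of the `k`-th polylogarithm: the holomorphic extension of the
power series to the cut plane. (Values of `L` on the cut are irrelevant.) -/
def IsPolylogPrincipalBranch (k : ℕ) (L : ℂ → ℂ) : Prop :=
  AnalyticOnNhd ℂ L cutPlane ∧ ∀ z ∈ Metric.ball (0 : ℂ) 1, L z = polylogSeries k z

end

/-! Let θ = z d/dz, so that θ Li_{k+1} = Li_k and θ^k Li_k = z/(1 - z).

Near 1 the principal branch is Li_{m+1}(z) = A_m(z) log(1 - z) + B(z), where A_m = -(log z)^m / m!
and B is holomorphic on |z - 1| < 1 (`exists_polylog_expansion`, by induction on m through θ A_{m+1}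
= A_m). The only multivalued term is log(1 - z), which gains 2πi on one positive turn around 1;
hence the branch continues along all paths in the punctured disc and its monodromy is 2πi A_m. Since
A_m has no zero in the punctured disc, 1 is a genuine singularity (`not_extends`).

For k ≥ 2, a loop from 0 around 1 leads back to 0 with the branch Li_k + 2πi A_{k-1}, which is
unbounded there because A_{k-1} is a nonconstant power of log z
(`zero_mem_continuationSingularities`).

No other point is singular: (1 - z) θ^k f = z persists under continuation, and on a disc avoiding 0
and 1 its solutions extend to the whole disc (`exists_extension_of_eulerOp_iterate`). -/

/-! ### Analytic continuation along curves -/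

theorem IsContinuationAlong.mono {γ : I → ℂ} {S T : Set I} {Φ : I → ℂ → ℂ}
    (h : IsContinuationAlong γ T Φ) (hST : S ⊆ T) : IsContinuationAlong γ S Φ where
  analyticAt t ht := h.analyticAt t (hST ht)
  eventuallyEq t ht := (h.eventuallyEq t (hST ht)).filter_mono (nhdsWithin_mono t hST)

/-- A function analytic along the whole curve is a continuation of itself. -/
theorem isContinuationAlong_const {γ : I → ℂ} {S : Set I} {f : ℂ → ℂ}
    (h : ∀ t ∈ S, AnalyticAt ℂ f (γ t)) : IsContinuationAlong γ S fun _ => f where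
  analyticAt := h
  eventuallyEq _ _ := Eventually.of_forall fun _ => EventuallyEq.rfl

/-- A local operator preserving analyticity maps continuations to continuations. -/
theorem IsContinuationAlong.map {γ : I → ℂ} {S : Set I} {Φ : I → ℂ → ℂ}
    (h : IsContinuationAlong γ S Φ) {H : (ℂ → ℂ) → ℂ → ℂ}
    (hloc : ∀ f g z, f =ᶠ[𝓝 z] g → H f =ᶠ[𝓝 z] H g)
    (han : ∀ f z, AnalyticAt ℂ f z → AnalyticAt ℂ (H f) z) :
    IsContinuationAlong γ S fun t => H (Φ t) where
  analyticAt t ht := han _ _ (h.analyticAt t ht)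
  eventuallyEq t ht := (h.eventuallyEq t ht).mono fun _ hs => hloc _ _ _ hs

/-- For two germs analytic at `p`, being equal is a property which is constant near `p`. -/
theorem eventually_eventuallyEq_iff {f g : ℂ → ℂ} {p : ℂ} (hf : AnalyticAt ℂ f p)
    (hg : AnalyticAt ℂ g p) : ∀ᶠ q in 𝓝 p, (f =ᶠ[𝓝 q] g ↔ f =ᶠ[𝓝 p] g) := by
  obtain ⟨ε, hε, hb⟩ := Metric.eventually_nhds_iff_ball.1
    (hf.eventually_analyticAt.and hg.eventually_analyticAt)
  filter_upwards [Metric.ball_mem_nhds p hε] with q hq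
  have key : ∀ x ∈ Metric.ball p ε, ∀ y ∈ Metric.ball p ε, f =ᶠ[𝓝 x] g → f =ᶠ[𝓝 y] g := by
    intro x hx y hy h
    have := AnalyticOnNhd.eqOn_of_preconnected_of_eventuallyEq (fun z hz => (hb z hz).1)
      (fun z hz => (hb z hz).2) (convex_ball p ε).isPreconnected hx h
    exact this.eventuallyEq_of_mem (Metric.isOpen_ball.mem_nhds hy)
  exact ⟨key q hq p (Metric.mem_ball_self hε), key p (Metric.mem_ball_self hε) q hq⟩

/-- Uniqueness of analytic continuation along a curve. -/
theorem IsContinuationAlong.unique {γ : I → ℂ} (hγ : Continuous γ) {S : Set I}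
    (hS : IsPreconnected S) {Φ Ψ : I → ℂ → ℂ} (hΦ : IsContinuationAlong γ S Φ)
    (hΨ : IsContinuationAlong γ S Ψ) {a : I} (ha : a ∈ S) (h : Φ a =ᶠ[𝓝 (γ a)] Ψ a)
    {b : I} (hb : b ∈ S) : Φ b =ᶠ[𝓝 (γ b)] Ψ b := by
  -- The relation "agreement at time x implies agreement at time y" is transitive, and it holds both
  -- ways between nearby times, so it holds throughout a preconnected set.
  refine hS.induction₂' (fun x y => Φ x =ᶠ[𝓝 (γ x)] Ψ x → Φ y =ᶠ[𝓝 (γ y)] Ψ y)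
    (fun t ht => ?_) (fun x y z _ _ _ h₁ h₂ h₃ => h₂ (h₁ h₃)) ha hb h
  have h1 := (hγ.continuousWithinAt (s := S) (x := t)).tendsto.eventually
    (eventually_eventuallyEq_iff (hΦ.analyticAt t ht) (hΨ.analyticAt t ht))
  filter_upwards [h1, hΦ.eventuallyEq t ht, hΨ.eventuallyEq t ht] with s hs hs1 hs2
  have : Φ s =ᶠ[𝓝 (γ s)] Ψ s ↔ Φ t =ᶠ[𝓝 (γ t)] Ψ t := by
    rw [← hs]
    exact ⟨fun h => (hs1.symm.trans h).trans hs2, fun h => (hs1.trans h).trans hs2.symm⟩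
  exact ⟨this.2, this.1⟩

/-- A continuation along `[0, 1)` extends to `[0, 1]` as soon as near the endpoint it is given by
a function analytic at the endpoint. -/
theorem continuesAlong_univ_of_eventuallyEq {γ : I → ℂ} {f F : ℂ → ℂ} {Φ : I → ℂ → ℂ}
    (hΦ : IsContinuationAlong γ (Iio 1) Φ) (h0 : Φ 0 =ᶠ[𝓝 (γ 0)] f)
    (hF : AnalyticAt ℂ F (γ 1)) (hΦF : ∀ᶠ s in 𝓝[<] (1 : I), Φ s =ᶠ[𝓝 (γ s)] F) :
    ContinuesAlong f γ univ := by
  classical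
  refine ⟨fun t => if t < 1 then Φ t else F, ⟨fun t _ => ?_, fun t _ => ?_⟩, ?_⟩
  · by_cases ht : t < 1
    · simpa [ht] using hΦ.analyticAt t ht
    · obtain rfl : t = 1 := le_antisymm unitInterval.le_one' (not_lt.1 ht)
      simpa using hF
  · rw [nhdsWithin_univ]
    by_cases ht : t < 1
    · have := hΦ.eventuallyEq t ht
      rw [IsOpen.nhdsWithin_eq isOpen_Iio (mem_Iio.2 ht)] at this
      filter_upwards [this, isOpen_Iio.mem_nhds ht] with s hs hs1
      simp only [mem_Iio] at hs1
      simpa [ht, hs1] using hs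
    · obtain rfl : t = 1 := le_antisymm unitInterval.le_one' (not_lt.1 ht)
      filter_upwards [eventually_nhdsWithin_iff.1 hΦF] with s hs
      by_cases hs1 : s < 1
      · simpa [hs1] using hs hs1
      · simp [hs1]
  · simpa using h0

/-- Conversely, a continuation along `[0, 1]` determines any continuation along `[0, 1)` and
yields a function analytic at the endpoint which represents it near the endpoint. -/
theorem ContinuesAlong.exists_analyticAt {γ : I → ℂ} (hγ : Continuous γ) {f : ℂ → ℂ}
    (h : ContinuesAlong f γ univ) {Φ : I → ℂ → ℂ} (hΦ : IsContinuationAlong γ (Iio 1) Φ)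
    (h0 : Φ 0 =ᶠ[𝓝 (γ 0)] f) :
    ∃ F, AnalyticAt ℂ F (γ 1) ∧ ∀ᶠ s in 𝓝[<] (1 : I), Φ s =ᶠ[𝓝 (γ s)] F := by
  obtain ⟨Ψ, hΨ, hΨ0⟩ := h
  refine ⟨Ψ 1, hΨ.analyticAt 1 trivial, ?_⟩
  have h1 := (hΨ.eventuallyEq 1 trivial).filter_mono (nhdsWithin_mono _ (subset_univ (Iio 1)))
  filter_upwards [h1, self_mem_nhdsWithin] with s hs hs1
  exact ((IsContinuationAlong.unique hγ isPreconnected_Iio hΦ (hΨ.mono (subset_univ _))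
    (mem_Iio.2 zero_lt_one) (h0.trans hΨ0.symm) hs1)).trans hs

/-! ### Logarithms along curves -/

/-- Two local lifts of the same function through the exponential agree near any point at which
they have the same value. -/
theorem eventuallyEq_of_exp_eq {f g : ℂ → ℂ} {p : ℂ} (hf : ContinuousAt f p)
    (hg : ContinuousAt g p) (h : ∀ᶠ w in 𝓝 p, Complex.exp (f w) = Complex.exp (g w))
    (hp : f p = g p) : f =ᶠ[𝓝 p] g := by
  have hc : ContinuousAt (fun w => (f w - g w).im) p :=
    Complex.continuous_im.continuousAt.comp (hf.sub hg)
  -- The difference has exponential 1; once its imaginary part lies in (-π, π), it is the principal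
  -- logarithm of 1, hence 0.
  have h0 : ∀ᶠ w in 𝓝 p, (f w - g w).im ∈ Ioo (-Real.pi) Real.pi :=
    hc.eventually_mem (Ioo_mem_nhds (by simp [hp, Real.pi_pos]) (by simp [hp, Real.pi_pos]))
  filter_upwards [h, h0] with w hw hw0
  have := Complex.log_exp hw0.1 hw0.2.le
  rw [Complex.exp_sub, hw, div_self (Complex.exp_ne_zero _), Complex.log_one] at this
  exact sub_eq_zero.1 this.symm

/-- Continuation of `A * log (1 - w) + B` along a curve avoiding `1`, given a continuous choice
`l` of `log (1 - γ)` along the curve. -/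
theorem isContinuationAlong_log {γ l : I → ℂ} {S : Set I} {A B : ℂ → ℂ} (hγ : Continuous γ)
    (hl : Continuous l) (hA : ∀ t ∈ S, AnalyticAt ℂ A (γ t)) (hB : ∀ t ∈ S, AnalyticAt ℂ B (γ t))
    (hexp : ∀ t, Complex.exp (l t) = 1 - γ t) :
    IsContinuationAlong γ S
      fun t w => A w * (l t + Complex.log ((1 - w) / (1 - γ t))) + B w := by
  have hne : ∀ t, 1 - γ t ≠ 0 := fun t => hexp t ▸ Complex.exp_ne_zero _
  -- The quotient equals 1 at w = γ t, so this is the branch of log(1 - w) with value l t at γ t.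
  have hlog : ∀ t, AnalyticAt ℂ (fun w => l t + Complex.log ((1 - w) / (1 - γ t))) (γ t) := by
    intro t
    refine analyticAt_const.add (AnalyticAt.clog ?_ (by simp [div_self (hne t)]))
    exact (analyticAt_const.sub analyticAt_id).div analyticAt_const (hne t)
  refine ⟨fun t ht => ((hA t ht).mul (hlog t)).add (hB t ht), fun t ht => ?_⟩
  have hc : ContinuousAt (fun s => (l s - l t).im) t := by fun_prop
  have h0 : ∀ᶠ s in 𝓝 t, (l s - l t).im ∈ Ioo (-Real.pi) Real.pi :=
    hc.eventually_mem (Ioo_mem_nhds (by simp [Real.pi_pos]) (by simp [Real.pi_pos]))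
  have h1 : ∀ᶠ s in 𝓝 t, AnalyticAt ℂ (fun w => l t + Complex.log ((1 - w) / (1 - γ t))) (γ s) :=
    hγ.continuousAt.eventually (hlog t).eventually_analyticAt
  refine Eventually.filter_mono nhdsWithin_le_nhds ?_
  filter_upwards [h0, h1] with s hs hs1
  have hw : ∀ᶠ w in 𝓝 (γ s), 1 - w ≠ 0 :=
    ContinuousAt.eventually_ne (by fun_prop) (hne s)
  have := eventuallyEq_of_exp_eq (hlog s).continuousAt hs1.continuousAt
    (hw.mono fun w hw => by
      rw [Complex.exp_add, Complex.exp_add, Complex.exp_log (div_ne_zero hw (hne s)),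
        Complex.exp_log (div_ne_zero hw (hne t)), hexp, hexp, mul_div_cancel₀ _ (hne s),
        mul_div_cancel₀ _ (hne t)])
    (by
      rw [div_self (hne s), ← hexp s, ← hexp t, ← Complex.exp_sub,
        Complex.log_exp hs.1 hs.2.le, Complex.log_one]; ring)
  filter_upwards [this] with w hw
  rw [hw]

/-- Continuous logarithms exist along curves avoiding `0`. -/
theorem exists_continuous_log {u : I → ℂ} (hu : Continuous u) (h0 : ∀ t, u t ≠ 0) {a : ℂ}
    (ha : Complex.exp a = u 0) :
    ∃ l : I → ℂ, Continuous l ∧ (∀ t, Complex.exp (l t) = u t) ∧ l 0 = a := by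
  obtain ⟨Γ, h, hΓ⟩ := Complex.isCoveringMap_exp.exists_path_lifts
    (⟨fun t => ⟨u t, h0 t⟩, by fun_prop⟩ : C(I, {z : ℂ // z ≠ 0})) a (by
      ext; simp [ha])
  exact ⟨Γ, Γ.continuous, fun t => congrArg Subtype.val (congrFun h t), hΓ⟩

/-! ### The cut plane and primitives on it -/

theorem mem_cutPlane_iff {z : ℂ} : z ∈ cutPlane ↔ 1 - z ∈ Complex.slitPlane := by
  simp only [cutPlane, mem_ofPred_eq, Complex.mem_slitPlane_iff, Complex.sub_re, Complex.one_re,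
    Complex.sub_im, Complex.one_im, zero_sub, ne_eq, neg_eq_zero, not_and_or, not_le, sub_pos]

theorem isOpen_cutPlane : IsOpen cutPlane := by
  have : cutPlane = (fun z : ℂ => 1 - z) ⁻¹' Complex.slitPlane := by
    ext z; exact mem_cutPlane_iff
  rw [this]
  exact Complex.isOpen_slitPlane.preimage (by fun_prop)

theorem ball_zero_one_subset_cutPlane : Metric.ball (0 : ℂ) 1 ⊆ cutPlane := by
  intro z hz h
  have := (Complex.re_le_norm z)
  rw [mem_ball_zero_iff] at hz
  linarith [h.1]

theorem ball_one_subset_slitPlane : Metric.ball (1 : ℂ) 1 ⊆ Complex.slitPlane := by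
  intro z hz
  have := Complex.abs_re_le_norm (z - 1)
  rw [mem_ball_iff_norm] at hz
  refine Or.inl ?_
  have h2 := (abs_lt.1 (this.trans_lt hz)).1
  simp at h2
  linarith

/-- The set is star-shaped about the real point c < 1: a point of a segment from c to z can be real
only if it is c itself or z is real, and a real z in the cut plane is < 1. -/
theorem isPreconnected_cutPlane_inter {K : Set ℂ} (hK : Convex ℝ K) {c : ℝ} (hc : c < 1)
    (hcK : (c : ℂ) ∈ K) : IsPreconnected (cutPlane ∩ K) := by
  have hcc : (c : ℂ) ∈ cutPlane := fun h => by
    have := h.1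
    simp at this
    linarith
  refine (StarConvex.isPathConnected (a := (c : ℂ)) (s := cutPlane ∩ K) ?_
    ⟨hcc, hcK⟩).isConnected.isPreconnected
  intro z hz a b ha hb hab
  refine ⟨fun h => ?_, hK hcK hz.2 ha hb hab⟩
  simp only [Complex.add_re, Complex.add_im, Complex.real_smul, Complex.mul_re, Complex.mul_im,
    Complex.ofReal_re, Complex.ofReal_im, zero_mul, sub_zero, mul_zero, add_zero, zero_add] at h
  rcases mul_eq_zero.1 h.2 with hb0 | hz0
  · subst hb0
    have : a = 1 := by linarith
    subst this
    linarith [h.1]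
  · have hz1 : z.re < 1 := not_le.1 fun h1 => hz.1 ⟨h1, hz0⟩
    have h1 := h.1
    rcases hb.eq_or_lt with rfl | hb'
    · have : a = 1 := by linarith
      subst this
      linarith
    · nlinarith

theorem isPreconnected_cutPlane : IsPreconnected cutPlane := by
  simpa using isPreconnected_cutPlane_inter convex_univ (c := 0) (by norm_num) (mem_univ _)

/-- Holomorphic functions on the cut plane have primitives. -/
theorem exists_primitive_cutPlane {f : ℂ → ℂ} (hf : DifferentiableOn ℂ f cutPlane) :
    ∃ F : ℂ → ℂ, ∀ z ∈ cutPlane, HasDerivAt F (f z) z := by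
  -- pull back by the biholomorphic map `K` from the unit disc, with inverse `J`
  set K : ℂ → ℂ := fun u => 1 - ((1 - u) / (1 + u)) ^ 2 with hK
  set W : ℂ → ℂ := fun z => Complex.exp (Complex.log (1 - z) / 2) with hW
  set J : ℂ → ℂ := fun z => (1 - W z) / (1 + W z) with hJ
  -- W is the principal square root of 1 - z, so its argument lies in (-π/2, π/2); the Cayley
  -- transform then maps the right half-plane to the disc.
  have hWre : ∀ z ∈ cutPlane, 0 < (W z).re := by
    intro z hz
    rw [mem_cutPlane_iff] at hz
    have h1 : (Complex.log (1 - z) / 2).im = Complex.arg (1 - z) / 2 := by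
      simp [Complex.log_im]
    have h2 := Complex.mem_slitPlane_iff_arg.1 hz
    simp only [hW]
    rw [Complex.exp_re, h1]
    refine mul_pos (Real.exp_pos _) (Real.cos_pos_of_mem_Ioo ⟨?_, ?_⟩)
    · linarith [Complex.neg_pi_lt_arg (1 - z)]
    · linarith [lt_of_le_of_ne (Complex.arg_le_pi (1 - z)) h2.1]
  have hre_ne : ∀ w : ℂ, 0 < w.re → 1 + w ≠ 0 := by
    intro w hw h
    have := congrArg Complex.re h
    simp at this
    linarith
  have hcayley : ∀ w : ℂ, 0 < w.re → ‖(1 - w) / (1 + w)‖ < 1 := by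
    intro w hw
    rw [norm_div, div_lt_one (norm_pos_iff.2 (hre_ne w hw))]
    refine lt_of_pow_lt_pow_left₀ 2 (norm_nonneg _) ?_
    rw [← Complex.normSq_eq_norm_sq, ← Complex.normSq_eq_norm_sq, Complex.normSq_apply,
      Complex.normSq_apply]
    simp
    nlinarith
  have hu_ne : ∀ u ∈ Metric.ball (0 : ℂ) 1, 1 + u ≠ 0 := by
    intro u hu h
    rw [mem_ball_zero_iff] at hu
    have : u = -1 := by linear_combination h
    simp [this] at hu
  have hcayley' : ∀ u ∈ Metric.ball (0 : ℂ) 1, 0 < ((1 - u) / (1 + u)).re := by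
    intro u hu
    have h1 := Complex.normSq_pos.2 (hu_ne u hu)
    rw [mem_ball_zero_iff] at hu
    have h2 : Complex.normSq u < 1 := by
      rw [Complex.normSq_eq_norm_sq]
      exact pow_lt_one₀ (norm_nonneg _) hu two_ne_zero
    rw [Complex.div_re, ← add_div]
    refine div_pos ?_ h1
    rw [Complex.normSq_apply] at h2
    simp
    nlinarith
  have hKmem : ∀ u ∈ Metric.ball (0 : ℂ) 1, K u ∈ cutPlane := by
    intro u hu
    rw [mem_cutPlane_iff, hK]
    have := hcayley' u hu
    set v := (1 - u) / (1 + u)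
    rw [sub_sub_cancel, Complex.mem_slitPlane_iff, pow_two, Complex.mul_re, Complex.mul_im]
    by_cases h : v.im = 0
    · left; rw [h]; nlinarith
    · right
      have : v.re * v.im ≠ 0 := mul_ne_zero this.ne' h
      intro h'
      apply this
      linarith
  have hKdiff : ∀ u ∈ Metric.ball (0 : ℂ) 1, DifferentiableAt ℂ K u := by
    intro u hu
    have := hu_ne u hu
    simp only [hK]
    fun_prop (disch := assumption)
  have hJmem : ∀ z ∈ cutPlane, J z ∈ Metric.ball (0 : ℂ) 1 := fun z hz => by
    rw [mem_ball_zero_iff]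
    exact hcayley _ (hWre z hz)
  have hJdiff : ∀ z ∈ cutPlane, DifferentiableAt ℂ J z := by
    intro z hz
    have h1 := hre_ne _ (hWre z hz)
    have h2 : DifferentiableAt ℂ W z :=
      (((differentiableAt_const _).sub differentiableAt_id).clog
        (mem_cutPlane_iff.1 hz) |>.div_const 2).cexp
    exact ((differentiableAt_const _).sub h2).div ((differentiableAt_const _).add h2) h1
  have hKJ : ∀ z ∈ cutPlane, K (J z) = z := by
    intro z hz
    have h1 := hre_ne _ (hWre z hz)
    have h2 : W z ^ 2 = 1 - z := by
      simp only [hW]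
      rw [← Complex.exp_nat_mul]
      have : (((2 : ℕ) : ℂ) * (Complex.log (1 - z) / 2)) = Complex.log (1 - z) := by
        push_cast; ring
      rw [this, Complex.exp_log (Complex.slitPlane_ne_zero (mem_cutPlane_iff.1 hz))]
    have h3 : (1 - J z) / (1 + J z) = W z := by
      simp only [hJ]
      field_simp
      ring
    simp only [hK]
    rw [h3, h2]
    ring
  have hcont : DifferentiableOn ℂ (fun u => f (K u) * deriv K u) (Metric.ball 0 1) := by
    have hKd : DifferentiableOn ℂ K (Metric.ball 0 1) :=
      fun u hu => (hKdiff u hu).differentiableWithinAt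
    exact (hf.comp hKd hKmem).mul (hKd.deriv Metric.isOpen_ball)
  obtain ⟨G, hG⟩ := hcont.isExactOn_ball
  refine ⟨G ∘ J, fun z hz => ?_⟩
  have h1 := (hG (J z) (hJmem z hz)).comp z (hJdiff z hz).hasDerivAt
  -- Since K ∘ J is the identity near z, the factor K' in the pulled-back integrand cancels J'.
  have h2 : HasDerivAt (K ∘ J) (deriv K (J z) * deriv J z) z :=
    (hKdiff _ (hJmem z hz)).hasDerivAt.comp z (hJdiff z hz).hasDerivAt
  have h3 : HasDerivAt (K ∘ J) 1 z :=
    (hasDerivAt_id z).congr_of_eventuallyEq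
      (eventually_of_mem (isOpen_cutPlane.mem_nhds hz) hKJ)
  have h4 := h2.unique h3
  have h5 : f (K (J z)) * deriv K (J z) * deriv J z = f z := by
    rw [hKJ z hz, mul_assoc, h4, mul_one]
  exact h5 ▸ h1

/-! ### The power series and its principal branch -/

/-- The Euler operator `z d/dz` and one value determine a holomorphic function. -/
theorem eqOn_of_mul_deriv_eq {U : Set ℂ} (hU : IsOpen U) (hUc : IsPreconnected U) {f g : ℂ → ℂ}
    (hf : DifferentiableOn ℂ f U) (hg : DifferentiableOn ℂ g U)
    (h : ∀ z ∈ U, z * deriv f z = z * deriv g z) {a : ℂ} (ha : a ∈ U) (hfg : f a = g a) :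
    EqOn f g U := by
  refine hU.eqOn_of_deriv_eq hUc hf hg (fun z hz => ?_) ha hfg
  by_cases hz0 : z = 0
  · subst hz0
    -- The factor z cannot be cancelled at 0; there the derivatives agree by continuity from the
    -- punctured neighbourhood.
    have h1 := ((hf.deriv hU).continuousOn.continuousAt (hU.mem_nhds hz))
    have h2 := ((hg.deriv hU).continuousOn.continuousAt (hU.mem_nhds hz))
    have h3 : deriv f =ᶠ[𝓝[≠] 0] deriv g := by
      filter_upwards [nhdsWithin_le_nhds (hU.mem_nhds hz), self_mem_nhdsWithin] with w hw hw0
      exact mul_left_cancel₀ hw0 (h w hw)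
    exact ((h1.eventuallyEq_nhds_iff_eventuallyEq_nhdsNE h2).1 h3).eq_of_nhds
  · exact mul_left_cancel₀ hz0 (h z hz)

theorem norm_polylog_term_le (k n : ℕ) {r : ℝ} {w : ℂ} (hw : w ∈ Metric.ball (0 : ℂ) r) :
    ‖w ^ (n + 1) / ((n : ℂ) + 1) ^ k‖ ≤ r ^ (n + 1) := by
  rw [mem_ball_zero_iff] at hw
  rw [norm_div, norm_pow, norm_pow]
  have h1 : ‖(n : ℂ) + 1‖ = (n : ℝ) + 1 := by
    exact_mod_cast Complex.norm_natCast (n + 1)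
  rw [h1]
  refine (div_le_self (by positivity) (one_le_pow₀ (by linarith [n.cast_nonneg (α := ℝ)]))).trans ?_
  exact pow_le_pow_left₀ (norm_nonneg _) hw.le _

theorem summable_pow_succ {r : ℝ} (h0 : 0 ≤ r) (h1 : r < 1) :
    Summable fun n : ℕ => r ^ (n + 1) :=
  (summable_nat_add_iff 1).2 (summable_geometric_of_lt_one h0 h1)

theorem differentiable_polylog_term (k n : ℕ) :
    Differentiable ℂ fun w : ℂ => w ^ (n + 1) / ((n : ℂ) + 1) ^ k :=
  (differentiable_id.pow _).div_const _

theorem differentiableOn_polylogSeries (k : ℕ) :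
    DifferentiableOn ℂ (polylogSeries k) (Metric.ball 0 1) := by
  intro z hz
  rw [mem_ball_zero_iff] at hz
  obtain ⟨r, hr, hr1⟩ := exists_between hz
  have := Complex.differentiableOn_tsum_of_summable_norm
    (summable_pow_succ ((norm_nonneg z).trans hr.le) hr1)
    (fun n => (differentiable_polylog_term k n).differentiableOn) Metric.isOpen_ball
    (fun n w hw => norm_polylog_term_le k n hw)
  exact (this.differentiableAt (Metric.isOpen_ball.mem_nhds
    (mem_ball_zero_iff.2 hr))).differentiableWithinAt

theorem mul_deriv_polylogSeries_succ (k : ℕ) {z : ℂ} (hz : z ∈ Metric.ball (0 : ℂ) 1) :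
    z * deriv (polylogSeries (k + 1)) z = polylogSeries k z := by
  rw [mem_ball_zero_iff] at hz
  obtain ⟨r, hr, hr1⟩ := exists_between hz
  have := Complex.hasSum_deriv_of_summable_norm
    (summable_pow_succ ((norm_nonneg z).trans hr.le) hr1)
    (fun n => (differentiable_polylog_term (k + 1) n).differentiableOn) Metric.isOpen_ball
    (fun n w hw => norm_polylog_term_le (k + 1) n hw) (mem_ball_zero_iff.2 hr)
  have h2 := this.mul_left z
  refine h2.tsum_eq.symm.trans (tsum_congr fun n => ?_)
  have hn : (n : ℂ) + 1 ≠ 0 := by exact_mod_cast n.succ_ne_zero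
  rw [deriv_div_const, deriv_pow_field]
  push_cast [Nat.add_sub_cancel]
  field_simp
  ring

theorem polylogSeries_apply_zero (k : ℕ) : polylogSeries k 0 = 0 := by
  simp [polylogSeries]

theorem polylogSeries_zero {z : ℂ} (hz : z ∈ Metric.ball (0 : ℂ) 1) :
    polylogSeries 0 z = z / (1 - z) := by
  rw [mem_ball_zero_iff] at hz
  simp only [polylogSeries, pow_zero, div_one, pow_succ, tsum_mul_right]
  rw [tsum_geometric_of_norm_lt_one hz]
  ring

theorem IsPolylogPrincipalBranch.differentiableOn {k : ℕ} {L : ℂ → ℂ}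
    (h : IsPolylogPrincipalBranch k L) : DifferentiableOn ℂ L cutPlane :=
  h.1.differentiableOn

theorem isPolylogPrincipalBranch_log :
    IsPolylogPrincipalBranch 1 fun z => -Complex.log (1 - z) := by
  have hd : ∀ z ∈ cutPlane, HasDerivAt (fun z => -Complex.log (1 - z)) (1 / (1 - z)) z := by
    intro z hz
    have : HasDerivAt (fun z => -Complex.log (1 - z)) (-(-1 / (1 - z))) z :=
      (((hasDerivAt_id z).const_sub 1).clog (mem_cutPlane_iff.1 hz)).neg
    rwa [neg_div, neg_neg] at this
  have hdiff : DifferentiableOn ℂ (fun z => -Complex.log (1 - z)) cutPlane :=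
    fun z hz => (hd z hz).differentiableAt.differentiableWithinAt
  refine ⟨hdiff.analyticOnNhd isOpen_cutPlane, ?_⟩
  refine eqOn_of_mul_deriv_eq Metric.isOpen_ball (convex_ball 0 1).isPreconnected
    (hdiff.mono ball_zero_one_subset_cutPlane) (differentiableOn_polylogSeries 1)
    (fun z hz => ?_) (Metric.mem_ball_self one_pos) (by simp [polylogSeries_apply_zero])
  rw [mul_deriv_polylogSeries_succ 0 hz, polylogSeries_zero hz,
    (hd z (ball_zero_one_subset_cutPlane hz)).deriv]
  ring

theorem IsPolylogPrincipalBranch.apply_zero {k : ℕ} {L : ℂ → ℂ}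
    (h : IsPolylogPrincipalBranch k L) : L 0 = 0 := by
  rw [h.2 0 (Metric.mem_ball_self one_pos), polylogSeries_apply_zero]

/-- Since L 0 = 0, `dslope L 0` is the holomorphic extension of L(z)/z across 0; its primitive
vanishing at 0 is the next polylogarithm. -/
theorem IsPolylogPrincipalBranch.exists_succ {k : ℕ} {L : ℂ → ℂ}
    (h : IsPolylogPrincipalBranch k L) : ∃ M, IsPolylogPrincipalBranch (k + 1) M := by
  have h0 : (0 : ℂ) ∈ cutPlane := ball_zero_one_subset_cutPlane (Metric.mem_ball_self one_pos)
  obtain ⟨F, hF⟩ := exists_primitive_cutPlane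
    ((Complex.differentiableOn_dslope (isOpen_cutPlane.mem_nhds h0)).2 h.differentiableOn)
  have hd : ∀ z ∈ cutPlane, HasDerivAt (fun z => F z - F 0) (dslope L 0 z) z :=
    fun z hz => (hF z hz).sub_const _
  have hdiff : DifferentiableOn ℂ (fun z => F z - F 0) cutPlane :=
    fun z hz => (hd z hz).differentiableAt.differentiableWithinAt
  refine ⟨fun z => F z - F 0, hdiff.analyticOnNhd isOpen_cutPlane, ?_⟩
  refine eqOn_of_mul_deriv_eq Metric.isOpen_ball (convex_ball 0 1).isPreconnected
    (hdiff.mono ball_zero_one_subset_cutPlane) (differentiableOn_polylogSeries _)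
    (fun z hz => ?_) (Metric.mem_ball_self one_pos) (by simp [polylogSeries_apply_zero])
  rw [mul_deriv_polylogSeries_succ k hz, (hd z (ball_zero_one_subset_cutPlane hz)).deriv,
    ← h.2 z hz]
  simpa [h.apply_zero] using sub_smul_dslope L 0 z

theorem exists_isPolylogPrincipalBranch (m : ℕ) : ∃ L, IsPolylogPrincipalBranch (m + 1) L := by
  induction m with
  | zero => exact ⟨_, isPolylogPrincipalBranch_log⟩
  | succ m ih =>
    obtain ⟨L, hL⟩ := ih
    exact hL.exists_succ

theorem IsPolylogPrincipalBranch.eqOn_of_eqOn_ball {k : ℕ} {L M : ℂ → ℂ}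
    (hL : IsPolylogPrincipalBranch k L) (hM : AnalyticOnNhd ℂ M cutPlane)
    (h : ∀ z ∈ Metric.ball (0 : ℂ) 1, M z = polylogSeries k z) : EqOn L M cutPlane :=
  hL.1.eqOn_of_preconnected_of_eventuallyEq hM isPreconnected_cutPlane
    (ball_zero_one_subset_cutPlane (Metric.mem_ball_self one_pos))
    (eventually_of_mem (Metric.ball_mem_nhds 0 one_pos) fun z hz =>
      (hL.2 z hz).trans (h z hz).symm)

theorem IsPolylogPrincipalBranch.mul_deriv_eqOn {k : ℕ} {L M : ℂ → ℂ}
    (hL : IsPolylogPrincipalBranch k L) (hM : IsPolylogPrincipalBranch (k + 1) M) :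
    EqOn L (fun z => z * deriv M z) cutPlane := by
  refine hL.eqOn_of_eqOn_ball (analyticOnNhd_id.mul hM.1.deriv) fun z hz => ?_
  have : M =ᶠ[𝓝 z] polylogSeries (k + 1) :=
    eventually_of_mem (Metric.isOpen_ball.mem_nhds hz) hM.2
  rw [this.deriv_eq, mul_deriv_polylogSeries_succ k hz]

/-! ### Expansion of the principal branch at 1 -/

/-- The coefficient of `log (1 - z)` in the expansion of the polylogarithm of order `m + 1`
near `1`. -/
noncomputable def polylogCoeff (m : ℕ) (z : ℂ) : ℂ := -(Complex.log z ^ m / (m.factorial : ℂ))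

theorem analyticAt_polylogCoeff (m : ℕ) {z : ℂ} (hz : z ∈ Complex.slitPlane) :
    AnalyticAt ℂ (polylogCoeff m) z :=
  (((analyticAt_clog hz).pow m).div_const).neg

theorem mul_deriv_polylogCoeff_succ (m : ℕ) {z : ℂ} (hz : z ∈ Complex.slitPlane) :
    z * deriv (polylogCoeff (m + 1)) z = polylogCoeff m z := by
  have h0 := Complex.slitPlane_ne_zero hz
  have h1 : HasDerivAt (polylogCoeff (m + 1)) _ z :=
    (((Complex.hasDerivAt_log hz).pow (m + 1)).div_const ((m + 1).factorial : ℂ)).neg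
  have h2 : ((m : ℂ) + 1) ≠ 0 := by exact_mod_cast m.succ_ne_zero
  have h3 : (m.factorial : ℂ) ≠ 0 := by exact_mod_cast m.factorial_ne_zero
  rw [h1.deriv, polylogCoeff, Nat.factorial_succ]
  push_cast [Nat.add_sub_cancel]
  field_simp

/-- The shape of the principal branch near `1`. -/
theorem exists_polylog_expansion (m : ℕ) {L : ℂ → ℂ} (hL : IsPolylogPrincipalBranch (m + 1) L) :
    ∃ B : ℂ → ℂ, AnalyticOnNhd ℂ B (Metric.ball 1 1) ∧
      ∀ z ∈ cutPlane ∩ Metric.ball 1 1, L z = polylogCoeff m z * Complex.log (1 - z) + B z := by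
  induction m generalizing L with
  | zero =>
    refine ⟨fun _ => 0, analyticOnNhd_const, fun z hz => ?_⟩
    rw [hL.eqOn_of_eqOn_ball isPolylogPrincipalBranch_log.1 isPolylogPrincipalBranch_log.2 hz.1]
    simp [polylogCoeff]
  | succ m ih =>
    obtain ⟨M, hM⟩ := exists_isPolylogPrincipalBranch m
    obtain ⟨B, hB, hMB⟩ := ih hM
    have hA : DifferentiableOn ℂ (polylogCoeff (m + 1)) (Metric.ball 1 1) := fun z hz =>
      (analyticAt_polylogCoeff _
        (ball_one_subset_slitPlane hz)).differentiableAt.differentiableWithinAt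
    have hne : ∀ z ∈ Metric.ball (1 : ℂ) 1, z ≠ 0 := fun z hz =>
      Complex.slitPlane_ne_zero (ball_one_subset_slitPlane hz)
    -- Differentiating the desired expansion forces the remainder to have derivative B/z + A/(1 -
    -- z), with A the new coefficient. As A(1) = 0, the second term is `-dslope A 1`, so there is no
    -- pole at 1.
    have hR : DifferentiableOn ℂ (fun z => B z / z - dslope (polylogCoeff (m + 1)) 1 z)
        (Metric.ball 1 1) :=
      (hB.differentiableOn.div differentiableOn_id hne).sub
        ((Complex.differentiableOn_dslope (Metric.ball_mem_nhds 1 one_pos)).2 hA)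
    -- The constant of integration is fixed at 1/2, a point of both the disc and the cut plane.
    obtain ⟨P, hPc, hP⟩ := hR.isExactOn_ball.with_val_at (1 / 2)
      (L (1 / 2) - polylogCoeff (m + 1) (1 / 2) * Complex.log (1 - 1 / 2))
    have hPd : DifferentiableOn ℂ P (Metric.ball 1 1) :=
      fun z hz => (hP z hz).differentiableAt.differentiableWithinAt
    refine ⟨P, hPd.analyticOnNhd Metric.isOpen_ball, ?_⟩
    have hhalf : (1 / 2 : ℂ) ∈ Metric.ball (1 : ℂ) 1 := by
      rw [mem_ball_iff_norm]; norm_num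
    have hhalf' : (1 / 2 : ℂ) ∈ cutPlane := by
      apply ball_zero_one_subset_cutPlane
      rw [mem_ball_zero_iff]; norm_num
    have hder : ∀ z ∈ cutPlane ∩ Metric.ball 1 1, HasDerivAt
        (fun z => polylogCoeff (m + 1) z * Complex.log (1 - z) + P z)
        (deriv (polylogCoeff (m + 1)) z * Complex.log (1 - z) +
          polylogCoeff (m + 1) z * (-1 / (1 - z)) +
          (B z / z - dslope (polylogCoeff (m + 1)) 1 z)) z := by
      intro z hz
      have h1 := (hA.differentiableAt (Metric.isOpen_ball.mem_nhds hz.2)).hasDerivAt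
      have h2 := ((hasDerivAt_id z).const_sub 1).clog (mem_cutPlane_iff.1 hz.1)
      exact (h1.mul h2).add (hP z hz.2)
    refine eqOn_of_mul_deriv_eq (isOpen_cutPlane.inter Metric.isOpen_ball)
      (isPreconnected_cutPlane_inter (convex_ball 1 1) (c := 1 / 2) (by norm_num)
        (by simpa using hhalf))
      (hL.differentiableOn.mono inter_subset_left)
      (fun z hz => (hder z hz).differentiableAt.differentiableWithinAt) (fun z hz => ?_)
      ⟨hhalf', hhalf⟩ (by rw [hPc]; ring)
    have hz1 : z ≠ 1 := fun h => hz.1 (by simp [h])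
    have hz0 := hne z hz.2
    have hc := mul_deriv_polylogCoeff_succ m (ball_one_subset_slitPlane hz.2)
    rw [(hder z hz).deriv, ← show M z = z * deriv L z from hM.mul_deriv_eqOn hL hz.1, hMB z hz,
      ← hc, dslope_of_ne _ hz1, slope, vsub_eq_sub, smul_eq_mul]
    have h1 : polylogCoeff (m + 1) 1 = 0 := by simp [polylogCoeff]
    have h2 : 1 - z ≠ 0 := sub_ne_zero.2 hz1.symm
    have h3 : z - 1 ≠ 0 := sub_ne_zero.2 hz1
    have h4 : (z - 1)⁻¹ = -(1 - z)⁻¹ := by rw [← neg_sub 1 z, inv_neg]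
    rw [h1, h4]
    field_simp
    ring

/-! ### Monodromy at 1 -/

theorem log_add_log_div_eventuallyEq {z : ℂ} (hz : z ∈ cutPlane) :
    (fun w => Complex.log (1 - z) + Complex.log ((1 - w) / (1 - z))) =ᶠ[𝓝 z]
      fun w => Complex.log (1 - w) := by
  have hz' := mem_cutPlane_iff.1 hz
  have hne := Complex.slitPlane_ne_zero hz'
  have hw : ∀ᶠ w in 𝓝 z, 1 - w ≠ 0 := ContinuousAt.eventually_ne (by fun_prop) hne
  refine eventuallyEq_of_exp_eq ?_ ?_ (hw.mono fun w hw => ?_) ?_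
  · refine continuousAt_const.add (ContinuousAt.clog ?_ (by simp [div_self hne]))
    fun_prop
  · exact ContinuousAt.clog (by fun_prop) hz'
  · rw [Complex.exp_add, Complex.exp_log hne, Complex.exp_log (div_ne_zero hw hne),
      Complex.exp_log hw, mul_div_cancel₀ _ hne]
  · simp [div_self hne]

/-- The germs of `A * log (1 - w) + B` at a point `z` of the cut plane, in terms of the value of
the logarithm at `z`. -/
theorem log_branch_eventuallyEq {L A B : ℂ → ℂ}
    (hLB : ∀ z ∈ cutPlane ∩ Metric.ball 1 1, L z = A z * Complex.log (1 - z) + B z) {z : ℂ}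
    (hz : z ∈ cutPlane ∩ Metric.ball 1 1) {a c : ℂ} (ha : a = Complex.log (1 - z) + c) :
    (fun w => A w * (a + Complex.log ((1 - w) / (1 - z))) + B w) =ᶠ[𝓝 z]
      fun w => L w + c * A w := by
  filter_upwards [log_add_log_div_eventuallyEq hz.1,
    (isOpen_cutPlane.inter Metric.isOpen_ball).mem_nhds hz] with w hw hwm
  rw [hLB w hwm, ha, ← hw]
  ring

theorem IsPolylogPrincipalBranch.continuesInPuncturedDisc {m : ℕ} {L : ℂ → ℂ}
    (hL : IsPolylogPrincipalBranch (m + 1) L) : ContinuesInPuncturedDisc L cutPlane 1 1 := by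
  obtain ⟨B, hB, hLB⟩ := exists_polylog_expansion m hL
  intro z hz w γ hγ
  have hne : ∀ t, 1 - γ t ≠ 0 := fun t => sub_ne_zero.2 fun h => (hγ t).2 h.symm
  obtain ⟨l, hl, hexp, hl0⟩ := exists_continuous_log (u := fun t => 1 - γ t) (by fun_prop) hne
    (a := Complex.log (1 - z))
    (by simp [Complex.exp_log (Complex.slitPlane_ne_zero (mem_cutPlane_iff.1 hz.1))])
  refine ⟨_, isContinuationAlong_log γ.continuous hl
    (fun t _ => analyticAt_polylogCoeff m (ball_one_subset_slitPlane (hγ t).1))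
    (fun t _ => hB _ (hγ t).1) hexp, ?_⟩
  have := log_branch_eventuallyEq hLB ⟨hz.1, hz.2.1⟩ (a := l 0) (c := 0) (by simp [hl0])
  simpa using this

theorem circleLoop_apply_sub (z : ℂ) (t : I) :
    1 - circleLoop 1 z t = (1 - z) * Complex.exp (2 * Real.pi * Complex.I * ((t : ℝ) : ℂ)) := by
  change 1 - (1 + (z - 1) * Complex.exp (2 * Real.pi * Complex.I * ((t : ℝ) : ℂ))) = _
  ring

theorem norm_circleLoop_sub (z : ℂ) (t : I) : ‖circleLoop 1 z t - 1‖ = ‖z - 1‖ := by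
  rw [← norm_neg, neg_sub, circleLoop_apply_sub, norm_mul, norm_sub_rev 1 z, Complex.norm_exp]
  simp

/-- Continuation of the principal branch once around `1`. -/
theorem IsPolylogPrincipalBranch.exists_continuation_circleLoop {m : ℕ} {L : ℂ → ℂ}
    (hL : IsPolylogPrincipalBranch (m + 1) L) {z : ℂ} (hz : z ∈ cutPlane ∩ puncturedDisc 1 1) :
    ∃ Φ, IsContinuationAlong (circleLoop 1 z) univ Φ ∧ Φ 0 =ᶠ[𝓝 z] L ∧
      Φ 1 =ᶠ[𝓝 z] fun w => L w + 2 * Real.pi * Complex.I * polylogCoeff m w := by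
  obtain ⟨B, hB, hLB⟩ := exists_polylog_expansion m hL
  have hmem : ∀ t, circleLoop 1 z t ∈ Metric.ball (1 : ℂ) 1 := fun t => by
    rw [mem_ball_iff_norm, norm_circleLoop_sub, ← mem_ball_iff_norm]
    exact hz.2.1
  have hne := Complex.slitPlane_ne_zero (mem_cutPlane_iff.1 hz.1)
  refine ⟨_, isContinuationAlong_log (circleLoop 1 z).continuous
    (l := fun t => Complex.log (1 - z) + 2 * Real.pi * Complex.I * ((t : ℝ) : ℂ)) (by fun_prop)
    (fun t _ => analyticAt_polylogCoeff m (ball_one_subset_slitPlane (hmem t)))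
    (fun t _ => hB _ (hmem t)) (fun t => ?_), ?_, ?_⟩
  · rw [circleLoop_apply_sub, Complex.exp_add, Complex.exp_log hne]
  · have := log_branch_eventuallyEq hLB ⟨hz.1, hz.2.1⟩ (a := Complex.log (1 - z)) (c := 0)
      (by simp)
    simpa using this
  · have := log_branch_eventuallyEq hLB ⟨hz.1, hz.2.1⟩
      (a := Complex.log (1 - z) + 2 * Real.pi * Complex.I) rfl
    simpa using this

theorem polylogCoeff_ne_zero (m : ℕ) {z : ℂ} (hz : z ∈ puncturedDisc 1 1) :
    polylogCoeff m z ≠ 0 := by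
  have h0 := Complex.slitPlane_ne_zero (ball_one_subset_slitPlane hz.1)
  have h1 : Complex.log z ≠ 0 := fun h => hz.2 (by
    have := Complex.exp_log h0
    rw [h, Complex.exp_zero] at this
    exact this.symm)
  exact neg_ne_zero.2 (div_ne_zero (pow_ne_zero _ h1) (by exact_mod_cast m.factorial_ne_zero))

/-- An extension g would be its own continuation around a small circle, so by uniqueness the
monodromy 2πi A would vanish at a point where A ≠ 0. -/
theorem IsPolylogPrincipalBranch.not_extends {m : ℕ} {L : ℂ → ℂ}
    (hL : IsPolylogPrincipalBranch (m + 1) L) :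
    ¬ ∃ g : ℂ → ℂ, AnalyticAt ℂ g 1 ∧ ∀ᶠ z in 𝓝[cutPlane] 1, g z = L z := by
  rintro ⟨g, hg, hgL⟩
  obtain ⟨ε, hε, hb⟩ := Metric.eventually_nhds_iff_ball.1
    (hg.eventually_analyticAt.and (eventually_nhdsWithin_iff.1 hgL))
  obtain ⟨δ, hδ, hδ'⟩ := exists_between (lt_min hε one_pos)
  obtain ⟨hδε, hδ1⟩ := lt_min_iff.1 hδ'
  set z : ℂ := 1 - (δ : ℂ) with hzdef
  have hz1 : ‖z - 1‖ = δ := by simp [hzdef, abs_of_pos hδ]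
  have hzc : z ∈ cutPlane := fun h => by
    have := h.1
    simp [hzdef] at this
    linarith
  have hz : z ∈ puncturedDisc 1 1 := by
    refine ⟨by rwa [mem_ball_iff_norm, hz1], fun h => ?_⟩
    rw [mem_singleton_iff.1 h] at hz1
    simp at hz1
    linarith
  have hzε : z ∈ Metric.ball 1 ε := by rwa [mem_ball_iff_norm, hz1]
  obtain ⟨Φ, hΦ, hΦ0, hΦ1⟩ := hL.exists_continuation_circleLoop ⟨hzc, hz⟩
  have hgc : IsContinuationAlong (circleLoop 1 z) univ fun _ => g :=
    isContinuationAlong_const fun t _ => (hb _ (by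
      rwa [mem_ball_iff_norm, norm_circleLoop_sub, hz1])).1
  have hgz : g =ᶠ[𝓝 z] L := by
    filter_upwards [Metric.isOpen_ball.mem_nhds hzε, isOpen_cutPlane.mem_nhds hzc] with w h1 h2
    exact (hb w h1).2 h2
  have h0 : Φ 0 =ᶠ[𝓝 (circleLoop 1 z 0)] g := by
    rw [(circleLoop 1 z).source]
    exact hΦ0.trans hgz.symm
  have h1 := IsContinuationAlong.unique (circleLoop 1 z).continuous isPreconnected_univ hΦ hgc
    (mem_univ 0) h0 (mem_univ 1)
  rw [(circleLoop 1 z).target] at h1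
  have h2 := ((hΦ1.symm.trans h1).trans hgz).eq_of_nhds
  refine mul_ne_zero Complex.two_pi_I_ne_zero (polylogCoeff_ne_zero m hz) ?_
  simpa using h2

/-- By uniqueness of continuation, the one explicit continuation around the circle decides the
monodromy for all of them. -/
theorem IsPolylogPrincipalBranch.hasMonodromyAt {m : ℕ} {L : ℂ → ℂ}
    (hL : IsPolylogPrincipalBranch (m + 1) L) :
    HasMonodromyAt L cutPlane 1 fun z => 2 * Real.pi * Complex.I * polylogCoeff m z := by
  refine ⟨1, one_pos, hL.continuesInPuncturedDisc, fun z hz Φ hΦ hΦ0 => ?_⟩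
  obtain ⟨Ψ, hΨ, hΨ0, hΨ1⟩ := hL.exists_continuation_circleLoop hz
  have h0 : Φ 0 =ᶠ[𝓝 (circleLoop 1 z 0)] Ψ 0 := by
    rw [(circleLoop 1 z).source]
    exact hΦ0.trans hΨ0.symm
  have h1 := IsContinuationAlong.unique (circleLoop 1 z).continuous isPreconnected_univ hΦ hΨ
    (mem_univ 0) h0 (mem_univ 1)
  rw [(circleLoop 1 z).target] at h1
  filter_upwards [h1.trans hΨ1] with w hw
  rw [hw]
  ring

/-! ### The singularities 1 and 0 -/

theorem analyticOnNhd_polylogSeries (k : ℕ) :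
    AnalyticOnNhd ℂ (polylogSeries k) (Metric.ball 0 1) :=
  (differentiableOn_polylogSeries k).analyticOnNhd Metric.isOpen_ball

/-- Along the segment [0, 1) the series continues itself. Were it to continue to 1, the identity
theorem on the cut plane near 1 would extend the principal branch across 1. -/
theorem one_mem_continuationSingularities (m : ℕ) :
    (1 : ℂ) ∈ continuationSingularities (polylogSeries (m + 1)) 0 := by
  let γ : Path (0 : ℂ) 1 :=
    { toFun := fun t => ((t : ℝ) : ℂ)
      continuous_toFun := by fun_prop
      source' := by simp
      target' := by simp }
  have hγ : ∀ t, γ t = ((t : ℝ) : ℂ) := fun _ => rfl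
  have hmem : ∀ t ∈ Iio (1 : I), γ t ∈ Metric.ball (0 : ℂ) 1 := fun t ht => by
    rw [mem_ball_zero_iff, hγ, Complex.norm_real, Real.norm_of_nonneg t.2.1]
    exact ht
  have hΦ : IsContinuationAlong γ (Iio 1) fun _ => polylogSeries (m + 1) :=
    isContinuationAlong_const fun t ht => analyticOnNhd_polylogSeries _ _ (hmem t ht)
  refine ⟨γ, ⟨_, hΦ, EventuallyEq.rfl⟩, fun h => ?_⟩
  obtain ⟨F, hF, hFs⟩ := h.exists_analyticAt γ.continuous hΦ EventuallyEq.rfl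
  rw [γ.target] at hF
  obtain ⟨L, hL⟩ := exists_isPolylogPrincipalBranch m
  obtain ⟨ε, hε, hb⟩ := Metric.eventually_nhds_iff_ball.1 hF.eventually_analyticAt
  have hball : ∀ᶠ s in 𝓝[<] (1 : I), γ s ∈ Metric.ball (1 : ℂ) ε :=
    (γ.continuous.continuousAt.eventually_mem
      (by rw [γ.target]; exact Metric.ball_mem_nhds 1 hε)).filter_mono nhdsWithin_le_nhds
  have := nhdsLT_neBot_of_exists_lt (⟨0, zero_lt_one⟩ : ∃ b, b < (1 : I))
  obtain ⟨s, ⟨hs, hsb⟩, hs1⟩ := ((hFs.and hball).and self_mem_nhdsWithin).exists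
  have hs0 := hmem s hs1
  have hLF : L =ᶠ[𝓝 (γ s)] F :=
    EventuallyEq.trans (eventually_of_mem (Metric.isOpen_ball.mem_nhds hs0) hL.2) hs
  have hconn : IsPreconnected (cutPlane ∩ Metric.ball (1 : ℂ) ε) :=
    isPreconnected_cutPlane_inter (convex_ball 1 ε) (c := (s : ℝ)) hs1 hsb
  have := AnalyticOnNhd.eqOn_of_preconnected_of_eventuallyEq (hL.1.mono inter_subset_left)
    (fun z hz => hb z hz.2) hconn ⟨ball_zero_one_subset_cutPlane hs0, hsb⟩ hLF
  refine hL.not_extends ⟨F, hF, eventually_nhdsWithin_iff.2 ?_⟩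
  filter_upwards [Metric.ball_mem_nhds 1 hε] with w hw hwc
  exact (this ⟨hwc, hw⟩).symm

theorem zero_mem_continuationSingularities (m : ℕ) :
    (0 : ℂ) ∈ continuationSingularities (polylogSeries (m + 1 + 1)) 0 := by
  -- The loop γ = 1 - exp(l) winds once around 1 at distance 1 - t(1 - t). This distance is 1 at
  -- both ends, where γ = 0, and lies strictly between 0 and 1 in between, so γ stays in the
  -- punctured disc where the expansion holds.
  let l : I → ℂ := fun t =>
    ((Real.log (1 - t * (1 - t)) : ℝ) : ℂ) + ((2 * Real.pi * t : ℝ) : ℂ) * Complex.I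
  have hpos : ∀ t : I, 0 < 1 - (t : ℝ) * (1 - t) := fun t => by
    nlinarith [sq_nonneg ((t : ℝ) - 1 / 2)]
  have hl : Continuous l := by
    have : Continuous fun t : I => Real.log (1 - t * (1 - t)) :=
      Continuous.log (by fun_prop) fun t => (hpos t).ne'
    fun_prop
  have hl_im : ∀ t, (l t).im = 2 * Real.pi * t := fun t => by simp [l]
  have hl_re : ∀ t, (l t).re = Real.log (1 - t * (1 - t)) := fun t => by simp [l]
  let γ : Path (0 : ℂ) 0 :=
    { toFun := fun t => 1 - Complex.exp (l t)
      continuous_toFun := by fun_prop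
      source' := by simp [l]
      target' := by simp [l, Complex.exp_two_pi_mul_I] }
  have hexp : ∀ t, Complex.exp (l t) = 1 - γ t := fun t => (sub_sub_cancel _ _).symm
  have hmem : ∀ t ∈ Ioo (0 : I) 1, γ t ∈ Metric.ball (1 : ℂ) 1 := fun t ht => by
    rw [mem_ball_iff_norm, norm_sub_rev, ← hexp, Complex.norm_exp, hl_re, Real.exp_log (hpos t)]
    have h0 : (0 : ℝ) < t := ht.1
    have h1 : (t : ℝ) < 1 := ht.2
    nlinarith
  obtain ⟨L, hL⟩ := exists_isPolylogPrincipalBranch (m + 1)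
  obtain ⟨B, hB, hLB⟩ := exists_polylog_expansion (m + 1) hL
  set A := polylogCoeff (m + 1)
  set f := polylogSeries (m + 1 + 1)
  let Ψ : I → ℂ → ℂ := fun t w => A w * (l t + Complex.log ((1 - w) / (1 - γ t))) + B w
  have hΨ : IsContinuationAlong γ (Ioo 0 1) Ψ := isContinuationAlong_log γ.continuous hl
    (fun t ht => analyticAt_polylogCoeff _ (ball_one_subset_slitPlane (hmem t ht)))
    (fun t ht => hB _ (hmem t ht)) hexp
  have hΨf : ∀ t ∈ Ioo (0 : I) 1, γ t ∈ Metric.ball (0 : ℂ) 1 → ∀ c : ℂ,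
      l t = Complex.log (1 - γ t) + c → Ψ t =ᶠ[𝓝 (γ t)] fun w => f w + c * A w := by
    intro t ht ht0 c hc
    refine (log_branch_eventuallyEq hLB
      ⟨ball_zero_one_subset_cutPlane ht0, hmem t ht⟩ hc).trans ?_
    filter_upwards [Metric.isOpen_ball.mem_nhds ht0] with w hw
    rw [hL.2 w hw]
  classical
  -- The point 0 lies on the boundary of the disc of the expansion, so the initial germ has to be
  -- the series itself.
  let Φ : I → ℂ → ℂ := fun t => if t = 0 then f else Ψ t
  have hΦ0 : Φ 0 = f := if_pos rfl
  have hΦt : ∀ t, 0 < t → Φ t = Ψ t := fun t ht => if_neg ht.ne'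
  have hnear : ∀ t, γ t = 0 → ∀ᶠ s in 𝓝 t, γ s ∈ Metric.ball (0 : ℂ) 1 := fun t ht =>
    γ.continuous.continuousAt.eventually_mem (by rw [ht]; exact Metric.ball_mem_nhds 0 one_pos)
  have hΦ : IsContinuationAlong γ (Iio 1) Φ := by
    refine ⟨fun t ht => ?_, fun t ht => ?_⟩
    · rcases (unitInterval.nonneg' (t := t)).eq_or_lt with rfl | h0
      · rw [hΦ0, γ.source]
        exact analyticOnNhd_polylogSeries _ _ (Metric.mem_ball_self one_pos)
      · rw [hΦt t h0]
        exact hΨ.analyticAt t ⟨h0, ht⟩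
    · rcases (unitInterval.nonneg' (t := t)).eq_or_lt with rfl | h0
      · have him : ∀ᶠ s in 𝓝 (0 : I), (l s).im < Real.pi :=
          (Complex.continuous_im.comp hl).continuousAt.eventually_lt continuousAt_const
            (by simp [hl_im, Real.pi_pos])
        rw [hΦ0]
        filter_upwards [nhdsWithin_le_nhds (hnear 0 γ.source), nhdsWithin_le_nhds him,
          self_mem_nhdsWithin] with s hs hs1 hs2
        rcases (unitInterval.nonneg' (t := s)).eq_or_lt with rfl | h0
        · rw [hΦ0]
        · rw [hΦt s h0]
          -- For small s the imaginary part of l s lies in [0, π), so l s is still the principal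
          -- logarithm.
          have := hΨf s ⟨h0, hs2⟩ hs 0 (by
            rw [← hexp, Complex.log_exp _ hs1.le, add_zero]
            rw [hl_im]
            have : (0 : ℝ) ≤ s := s.2.1
            nlinarith [Real.pi_pos])
          simpa using this
      · have h := hΨ.eventuallyEq t ⟨h0, ht⟩
        rw [IsOpen.nhdsWithin_eq isOpen_Ioo (mem_Ioo.2 ⟨h0, ht⟩)] at h
        rw [hΦt t h0]
        filter_upwards [nhdsWithin_le_nhds h, nhdsWithin_le_nhds (isOpen_Ioi.mem_nhds h0)]
          with s hs hs0
        rwa [hΦt s hs0]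
  have hΦ0' : Φ 0 =ᶠ[𝓝 (γ 0)] f := by rw [hΦ0]
  refine ⟨γ, ⟨Φ, hΦ, hΦ0'⟩, fun h => ?_⟩
  obtain ⟨F, hF, hFs⟩ := h.exists_analyticAt γ.continuous hΦ hΦ0'
  rw [γ.target] at hF
  obtain ⟨ε, hε, hb⟩ := Metric.eventually_nhds_iff_ball.1 (hF.eventually_analyticAt.and
    ((analyticOnNhd_polylogSeries (m + 1 + 1)) 0
      (Metric.mem_ball_self one_pos)).eventually_analyticAt)
  have hball : ∀ᶠ s in 𝓝 (1 : I), γ s ∈ Metric.ball (0 : ℂ) ε :=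
    γ.continuous.continuousAt.eventually_mem (by rw [γ.target]; exact Metric.ball_mem_nhds 0 hε)
  have him : ∀ᶠ s in 𝓝 (1 : I), Real.pi < (l s).im :=
    continuousAt_const.eventually_lt (Complex.continuous_im.comp hl).continuousAt
      (by simp [hl_im]; linarith [Real.pi_pos])
  have := nhdsLT_neBot_of_exists_lt (⟨0, zero_lt_one⟩ : ∃ b, b < (1 : I))
  obtain ⟨s, ⟨⟨⟨hs, hsε⟩, hs0⟩, hsim⟩, hs1⟩ :=
    ((((hFs.and (nhdsWithin_le_nhds hball)).and (nhdsWithin_le_nhds (hnear 1 γ.target))).and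
      (nhdsWithin_le_nhds him)).and self_mem_nhdsWithin).exists
  have hs1' : (s : ℝ) < 1 := hs1
  have hspos : 0 < s := by
    rw [hl_im] at hsim
    refine lt_of_le_of_ne unitInterval.nonneg' ?_
    rintro rfl
    simp at hsim
    linarith [Real.pi_pos]
  -- Near the end of the loop the imaginary part of l s lies in (π, 2π), one period above the
  -- principal logarithm.
  have hls : l s = Complex.log (1 - γ s) + 2 * Real.pi * Complex.I := by
    have : Complex.exp (l s - 2 * Real.pi * Complex.I) = 1 - γ s := by
      rw [Complex.exp_sub, Complex.exp_two_pi_mul_I, div_one, hexp]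
    rw [← this, Complex.log_exp, sub_add_cancel]
    · simp
      linarith
    · rw [hl_im] at hsim
      simp [hl_im]
      nlinarith [Real.pi_pos]
  have hkey := (hΨf s ⟨hspos, hs1⟩ hs0 _ hls).symm.trans ((hΦt s hspos) ▸ hs)
  -- On this convex lens the identity theorem carries F = f + 2πi A from γ s to the small positive
  -- reals, where A blows up while F and f stay bounded.
  have hU := ((convex_ball (0 : ℂ) ε).inter (convex_ball (1 : ℂ) 1)).isPreconnected
  have hEq := AnalyticOnNhd.eqOn_of_preconnected_of_eventuallyEq
    (fun z hz => (hb z hz.1).2.add (analyticAt_const.mul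
      (analyticAt_polylogCoeff (m + 1) (ball_one_subset_slitPlane hz.2))))
    (fun z hz => (hb z hz.1).1) hU ⟨hsε, hmem s ⟨hspos, hs1⟩⟩ hkey
  -- compare the behaviour of both sides at the positive reals near `0`
  have hlim : Tendsto (fun x : ℝ => ‖F x - f x‖) (𝓝[>] 0) (𝓝 ‖F 0 - f 0‖) := by
    have h1 : ContinuousAt (fun z => ‖F z - f z‖) (((0 : ℝ) : ℂ)) := by
      rw [Complex.ofReal_zero]
      exact ((hb 0 (Metric.mem_ball_self hε)).1.continuousAt.sub
        (hb 0 (Metric.mem_ball_self hε)).2.continuousAt).norm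
    have h2 := (h1.comp (f := fun x : ℝ => (x : ℂ))
      Complex.continuous_ofReal.continuousAt).tendsto.mono_left
      (nhdsWithin_le_nhds (s := Ioi (0 : ℝ)))
    simpa only [Function.comp_def, Complex.ofReal_zero] using h2
  -- The exponent m + 1 = k - 1 is positive; for k = 1 the coefficient would be constant and nothing
  -- would diverge.
  have hlog : Tendsto (fun x : ℝ => 2 * Real.pi * (|Real.log x| ^ (m + 1) / (m + 1).factorial))
      (𝓝[>] 0) atTop := by
    refine Tendsto.const_mul_atTop (by positivity) (Tendsto.atTop_div_const
      (by exact_mod_cast Nat.factorial_pos _) ?_)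
    exact (tendsto_pow_atTop m.succ_ne_zero).comp
      (tendsto_abs_atBot_atTop.comp Real.tendsto_log_nhdsGT_zero)
  refine not_tendsto_nhds_of_tendsto_atTop hlog _ (hlim.congr' ?_)
  filter_upwards [Ioo_mem_nhdsGT (lt_min hε one_pos)] with x hx
  have hx0 := hx.1
  have hx2 := lt_min_iff.1 hx.2
  have hxU : (x : ℂ) ∈ Metric.ball (0 : ℂ) ε ∩ Metric.ball (1 : ℂ) 1 := by
    refine ⟨by simpa [abs_of_pos hx0] using hx2.1, ?_⟩
    rw [mem_ball_iff_norm, ← Complex.ofReal_one, ← Complex.ofReal_sub, Complex.norm_real,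
      Real.norm_eq_abs, abs_lt]
    constructor <;> linarith [hx2.2]
  rw [← hEq hxU, Pi.add_apply, add_sub_cancel_left, Pi.mul_apply, polylogCoeff,
    ← Complex.ofReal_log hx0.le]
  simp [abs_of_pos Real.pi_pos]

/-! ### No other singularities -/

/-- The Euler operator `z d/dz`. -/
noncomputable def eulerOp (f : ℂ → ℂ) (z : ℂ) : ℂ := z * deriv f z

theorem eulerOp_iterate_congr (k : ℕ) {f g : ℂ → ℂ} {z : ℂ} (h : f =ᶠ[𝓝 z] g) :
    eulerOp^[k] f =ᶠ[𝓝 z] eulerOp^[k] g := by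
  induction k generalizing f g with
  | zero => exact h
  | succ k ih => exact ih (EventuallyEq.rfl.mul h.deriv)

theorem AnalyticAt.eulerOp_iterate (k : ℕ) {f : ℂ → ℂ} {z : ℂ} (h : AnalyticAt ℂ f z) :
    AnalyticAt ℂ (eulerOp^[k] f) z := by
  induction k generalizing f with
  | zero => exact h
  | succ k ih => exact ih (analyticAt_id.mul h.deriv)

theorem eulerOp_iterate_polylogSeries (k : ℕ) {z : ℂ} (hz : z ∈ Metric.ball (0 : ℂ) 1) :
    eulerOp^[k] (polylogSeries k) =ᶠ[𝓝 z] polylogSeries 0 := by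
  induction k with
  | zero => rfl
  | succ k ih =>
    refine (eulerOp_iterate_congr k ?_).trans ih
    exact eventually_of_mem (Metric.isOpen_ball.mem_nhds hz)
      fun w hw => mul_deriv_polylogSeries_succ k hw

/-- On a disc avoiding `0`, solutions of `(z d/dz)^k f = R` extend to the whole disc. -/
theorem exists_extension_of_eulerOp_iterate (k : ℕ) {α : ℂ} {r : ℝ}
    (h0 : (0 : ℂ) ∉ Metric.ball α r) {R : ℂ → ℂ} (hR : DifferentiableOn ℂ R (Metric.ball α r))
    {f : ℂ → ℂ} {p : ℂ} (hp : p ∈ Metric.ball α r) (hf : AnalyticAt ℂ f p)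
    (h : eulerOp^[k] f =ᶠ[𝓝 p] R) :
    ∃ F, DifferentiableOn ℂ F (Metric.ball α r) ∧ f =ᶠ[𝓝 p] F := by
  induction k generalizing f with
  | zero => exact ⟨R, hR, h⟩
  | succ k ih =>
    obtain ⟨G, hG, hfG⟩ := ih (hf.eulerOp_iterate 1) h
    have hne : ∀ z ∈ Metric.ball α r, z ≠ 0 := fun z hz hz0 => h0 (hz0 ▸ hz)
    -- G extends θf to the disc, so f is recovered as the primitive of G/z with the right value at
    -- p.
    obtain ⟨P, hPp, hP⟩ := (hG.div differentiableOn_id hne).isExactOn_ball.with_val_at p (f p)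
    refine ⟨P, fun z hz => (hP z hz).differentiableAt.differentiableWithinAt, ?_⟩
    obtain ⟨ε, hε, hb⟩ := Metric.eventually_nhds_iff_ball.1
      ((hf.eventually_analyticAt.and hfG).and (Metric.isOpen_ball.mem_nhds hp))
    have := Metric.isOpen_ball.eqOn_of_deriv_eq (convex_ball p ε).isPreconnected
      (fun z hz => (hb z hz).1.1.differentiableAt.differentiableWithinAt)
      (fun z hz => (hP z (hb z hz).2).differentiableAt.differentiableWithinAt)
      (fun z hz => by
        have h1 : z * deriv f z = G z := (hb z hz).1.2
        have h2 := hne z (hb z hz).2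
        rw [(hP z (hb z hz).2).deriv, Pi.div_apply, ← h1, id]
        field_simp) (Metric.mem_ball_self hε) hPp.symm
    exact eventually_of_mem (Metric.ball_mem_nhds p hε) this

theorem continuationSingularities_polylogSeries_subset (k : ℕ) :
    continuationSingularities (polylogSeries k) 0 ⊆ {0, 1} := by
  rintro α ⟨γ, ⟨Φ, hΦ, hΦ0⟩, hnot⟩
  by_contra hα
  simp only [mem_insert_iff, mem_singleton_iff, not_or] at hα
  refine hnot ?_
  -- With the denominator cleared, both sides are analytic germs at every point of the path, which
  -- may pass through 0 or 1 before its end; uniqueness then propagates the equation from time 0.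
  have hode : ∀ t ∈ Iio (1 : I),
      (fun z => (1 - z) * eulerOp^[k] (Φ t) z) =ᶠ[𝓝 (γ t)] id := by
    intro t ht
    refine IsContinuationAlong.unique γ.continuous isPreconnected_Iio
      (hΦ.map (H := fun f z => (1 - z) * eulerOp^[k] f z)
        (fun f g z h => EventuallyEq.rfl.mul (eulerOp_iterate_congr k h))
        (fun f z h => (analyticAt_const.sub analyticAt_id).mul (h.eulerOp_iterate k)))
      (isContinuationAlong_const fun _ _ => analyticAt_id) (mem_Iio.2 zero_lt_one) ?_ ht
    have h1 := eulerOp_iterate_congr k hΦ0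
    rw [γ.source] at h1 ⊢
    have h2 := eulerOp_iterate_polylogSeries k (Metric.mem_ball_self (x := (0 : ℂ)) one_pos)
    filter_upwards [h1, h2, Metric.ball_mem_nhds 0 one_pos] with z hz1 hz2 hz
    have hne : 1 - z ≠ 0 :=
      Complex.slitPlane_ne_zero (mem_cutPlane_iff.1 (ball_zero_one_subset_cutPlane hz))
    rw [hz1, hz2, polylogSeries_zero hz, mul_div_cancel₀ _ hne, id]
  obtain ⟨r, hr, hb⟩ := Metric.eventually_nhds_iff_ball.1
    ((eventually_ne_nhds hα.1).and (eventually_ne_nhds hα.2))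
  have hball : ∀ᶠ s in 𝓝[≤] (1 : I), γ s ∈ Metric.ball α r :=
    (γ.continuous.continuousAt.eventually_mem
      (by rw [γ.target]; exact Metric.ball_mem_nhds α hr)).filter_mono nhdsWithin_le_nhds
  -- From some time b < 1 on, the path stays in a disc about α avoiding 0 and 1; the solution
  -- extended from γ b to that disc represents the continuation up to the endpoint.
  obtain ⟨a, ha1, ha⟩ := (mem_nhdsLE_iff_exists_Ioc_subset' (zero_lt_one (α := I))).1 hball
  obtain ⟨b, hab, hb1⟩ := exists_between (mem_Iio.1 ha1)
  have hγb : ∀ t, b ≤ t → γ t ∈ Metric.ball α r := fun t ht =>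
    ha ⟨hab.trans_le ht, unitInterval.le_one'⟩
  obtain ⟨F, hF, hFb⟩ := exists_extension_of_eulerOp_iterate k (fun h => (hb 0 h).1 rfl)
    (R := fun z => z / (1 - z))
    (fun z hz => (differentiableAt_id.div ((differentiableAt_const 1).sub differentiableAt_id)
      (sub_ne_zero.2 (hb z hz).2.symm)).differentiableWithinAt)
    (hγb b le_rfl) (hΦ.analyticAt b hb1) (by
      filter_upwards [hode b hb1, Metric.isOpen_ball.mem_nhds (hγb b le_rfl)] with z hz hzb
      rw [eq_div_iff (sub_ne_zero.2 (hb z hzb).2.symm), mul_comm]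
      exact hz)
  have hFan := hF.analyticOnNhd Metric.isOpen_ball
  refine continuesAlong_univ_of_eventuallyEq hΦ hΦ0 (hFan _ (hγb 1 hb1.le)) ?_
  filter_upwards [Ico_mem_nhdsLT hb1] with t ht
  exact IsContinuationAlong.unique γ.continuous isPreconnected_Ico
    (hΦ.mono fun s (hs : s ∈ Ico b 1) => hs.2)
    (isContinuationAlong_const fun s hs => hFan _ (hγb s hs.1)) (left_mem_Ico.2 hb1) hFb ht

theorem mainTheorem7 :
    (∀ k : ℕ, 2 ≤ k → continuationSingularities (polylogSeries k) 0 = {0, 1}) ∧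
    (∀ k : ℕ, 1 ≤ k →
      (∃ L : ℂ → ℂ, IsPolylogPrincipalBranch k L) ∧
      ∀ L : ℂ → ℂ, IsPolylogPrincipalBranch k L →
        HasIsolatedSingularityAt L cutPlane 1 ∧
        ∃ Δ : ℂ → ℂ, AnalyticAt ℂ Δ 1 ∧ HasMonodromyAt L cutPlane 1 Δ ∧
          ∀ᶠ z in 𝓝 (1 : ℂ),
            Δ z = -(2 * Real.pi * Complex.I / (Nat.factorial (k - 1) : ℂ)) *
              Complex.log z ^ (k - 1)) := by
  refine ⟨fun k hk => ?_, fun k hk => ?_⟩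
  · obtain ⟨m, rfl⟩ := Nat.exists_eq_add_of_le' hk
    refine (continuationSingularities_polylogSeries_subset _).antisymm ?_
    rintro α (rfl | rfl)
    · exact zero_mem_continuationSingularities m
    · exact one_mem_continuationSingularities (m + 1)
  · obtain ⟨m, rfl⟩ := Nat.exists_eq_add_of_le' hk
    refine ⟨exists_isPolylogPrincipalBranch m, fun L hL =>
      ⟨⟨⟨1, one_pos, hL.continuesInPuncturedDisc⟩, hL.not_extends⟩,
        fun z => 2 * Real.pi * Complex.I * polylogCoeff m z,
        analyticAt_const.mul (analyticAt_polylogCoeff m Complex.one_mem_slitPlane),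
        hL.hasMonodromyAt, Eventually.of_forall fun z => ?_⟩⟩
    simp only [polylogCoeff, Nat.add_sub_cancel]
    ring
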